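/- All graphs are finite and loopless, but may have parallel edges. For an integer $r \ge 1$, an $r$-regular graph $G$ is called an $r$-graph if for every $S \subseteq V(G)$ with $|S|$ odd there are at least $r$ edges of $G$ with precisely one end in $S$. A $k$-factor of $G$ is a spanning $k$-regular subgraph of $G$. A graph is $t$-edge-connected if it has at least two vertices and stays connected after the removal of any set of fewer than $t$ edges. Theorem. Let $t, r$ be positive integers with $r \ge 4$, where $t = r$ if $r \equiv 0 \pmod 4$, $t = r-1$ if $r$ is odd, and $t = r-2$ if $r \equiv 2 \pmod 4$. Then there are infinitely many pairwise non-isomorphic $t$-edge-connected $r$-graphs which do not contain $r-2$ pairwise edge-disjoint $1$-factors. Moreover, whenever $4$ divides $r$, Thomassen's question "Is every $r$-regular $r$-edge-connected graph of even order the union of $r-2$ $1$-factors and a $2$-factor?" has a negative answer for $r$. -/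

import Mathlib

/-! Multigraphs are Mathlib's `Graph α β` (vertex set `V(G)`, edge set `E(G)`, parallel edges allowed). -/

open scoped Graph

namespace Graph

variable {α β α' β' : Type*}

/-- The standing convention: a graph is finite and loopless, parallel edges being allowed. -/
structure IsFiniteLoopless (G : Graph α β) : Prop where
  finite_vertexSet : V(G).Finite
  finite_edgeSet : E(G).Finite
  loopless : G.Loopless

/-- The degree of a vertex: the number of incident edges, loops being counted twice. -/
noncomputable def vertexDegree (G : Graph α β) (v : α) : ℕ∞ :=
  {e | G.Inc e v}.encard + {e | G.IsLoopAt e v}.encard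

/-- `G` is `k`-regular if every vertex has degree `k`. -/
def IsRegular (G : Graph α β) (k : ℕ) : Prop :=
  ∀ v ∈ V(G), G.vertexDegree v = k

/-- `∂_G(S)`: the set of edges of `G` with precisely one end in `S`. -/
def edgeBoundary (G : Graph α β) (S : Set α) : Set β :=
  {e | ∃ x y, G.IsLink e x y ∧ x ∈ S ∧ y ∉ S}

/-- An `r`-graph is an `r`-regular graph with `|∂_G(S)| ≥ r` for every `S ⊆ V(G)` with `|S|` odd. -/
def IsRGraph (G : Graph α β) (r : ℕ) : Prop :=
  G.IsRegular r ∧ ∀ S ⊆ V(G), Odd S.ncard → (r : ℕ∞) ≤ (G.edgeBoundary S).encard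

/-- Any two vertices of `G` are joined by a walk. -/
def IsPreconnected (G : Graph α β) : Prop :=
  ∀ x ∈ V(G), ∀ y ∈ V(G), Relation.ReflTransGen G.Adj x y

/-- `G` is `t`-edge-connected if it has at least two vertices and remains connected after the
deletion of any set of fewer than `t` edges. -/
def IsEdgeConnected (G : Graph α β) (t : ℕ) : Prop :=
  V(G).Nontrivial ∧ ∀ F ⊆ E(G), F.encard < t → (G.deleteEdges F).IsPreconnected

/-- `H` is a `k`-factor of `G` if it is a spanning `k`-regular subgraph of `G`. -/
def IsFactor (H G : Graph α β) (k : ℕ) : Prop :=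
  H ≤s G ∧ H.IsRegular k

/-- `G` contains `n` pairwise (edge-)disjoint `1`-factors. -/
def HasDisjointOneFactors (G : Graph α β) (n : ℕ) : Prop :=
  ∃ M : Fin n → Graph α β, (∀ i, (M i).IsFactor G 1) ∧
    Pairwise fun i j => Disjoint E(M i) E(M j)

/-- `G` is the union of `n` `1`-factors and a `2`-factor (these are spanning subgraphs, so only
the edge sets matter for the union). -/
def IsUnionOfOneFactorsAndTwoFactor (G : Graph α β) (n : ℕ) : Prop :=
  ∃ (M : Fin n → Graph α β) (H : Graph α β), (∀ i, (M i).IsFactor G 1) ∧ H.IsFactor G 2 ∧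
    E(G) = (⋃ i, E(M i)) ∪ E(H)

/-- Isomorphism of multigraphs: bijections between the vertex sets and between the edge sets
that preserve and reflect incidence. -/
def IsIsomorphic (G : Graph α β) (H : Graph α' β') : Prop :=
  ∃ (f : V(G) ≃ V(H)) (g : E(G) ≃ E(H)), ∀ (e : E(G)) (x y : V(G)),
    G.IsLink e x y ↔ H.IsLink (g e) (f x) (f y)

end Graph

/-- A positive answer to Thomassen's question for the integer `r`: every `r`-regular
`r`-edge-connected graph of even order is the union of `r - 2` `1`-factors and a `2`-factor. -/
def ThomassenProperty (r : ℕ) : Prop :=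
  ∀ (α β : Type) (G : Graph α β), G.IsFiniteLoopless → G.IsRegular r → G.IsEdgeConnected r →
    Even V(G).ncard → G.IsUnionOfOneFactorsAndTwoFactor (r - 2)

/-!
Multigraphs are described by symmetric weight functions `w : V → V → ℕ`, and a family of disjoint
`1`-factors by a packing of involutions (`IsPacking`).

The source of the obstruction is the Petersen graph, which has exactly six perfect matchings, any
two of them sharing exactly one edge. Add `r - 3` further perfect matchings to it. If `r - 2`
disjoint perfect matchings are taken out of the resulting `r`-regular graph, then counting them by
type shows that they use any given edge at least as often as its multiplicity minus one
(`IsPacking.le_card_gadget`). Cut such an edge `uv` of multiplicity `m` open and use what remains to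
replace an edge `xy` of multiplicity `m` in another graph (`glue`). By parity, a perfect matching of
the result uses either both or none of the two new connections, so it restricts to both sides
(`IsPacking.of_glue`). Hence gluing in a gadget at `xy` means: only those packings of `r - 2` perfect
matchings that leave at most one copy of `xy` uncovered survive.

The base graph (`baseWeight`) has three vertices, each joined to `{0, 1, 2, 3}` by an edge of even
multiplicity `p` and to `{7, 8, 9}` by an edge of multiplicity `q = r - p`. If at most one copy of
each of these six edges may remain uncovered, then exactly one copy of each does, and the packing
uses `3 (p - 1)` edges leaving the even set `{0, 1, 2, 3}`. This is odd, which is impossible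
(`base_no_packing`). So after gadgets have been glued in at the six edges no `r - 2` disjoint
`1`-factors exist. With `p` and `q` as nearly equal as the parity of `p` allows, all cuts are at
least `t = 2 min(p, q)`, and at least `r` for odd sets. This is tracked through the gluings by the
invariant `IsGood`. Gluing in further gadgets gives infinitely many orders (`exists_isGood`).

If `G` is `r`-regular and the union of `r - 2` `1`-factors and a `2`-factor, then these factors are
disjoint by a degree count, so for `4 ∣ r`, when `t = r`, Thomassen's question is answered in the
negative.
-/

open scoped Graph

namespace WeightedGraph

/-! ### Weighted graphs and their gluing -/

variable {V V₁ V₂ ι : Type*}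

/-- The total weight of the pairs leaving `S`; vertex sets are given by their indicator functions,
so that statements about all subsets of a concrete vertex set are decidable by enumeration. -/
def cut [Fintype V] (w : V → V → ℕ) (S : V → Bool) : ℕ :=
  ∑ a, ∑ b, if S a && !S b then w a b else 0

/-- The number of vertices of the set with indicator function `S`. -/
def size [Fintype V] (S : V → Bool) : ℕ := ∑ a, (S a).toNat

/-- A family of perfect matchings, each encoded as the involution `F j` exchanging matched
vertices, that can be realised edge-disjointly: no pair `a b` is used more than `w a b` times.
If `w` vanishes on the diagonal, this forces the involutions to be fixed-point free. -/
structure IsPacking [DecidableEq V] [Fintype ι] (w : V → V → ℕ) (F : ι → V → V) : Prop where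
  invol : ∀ j a, F j (F j a) = a
  card_le : ∀ a b, (Finset.univ.filter fun j => F j a = b).card ≤ w a b

/-- The gluing of `w₁` and `w₂` along the edges `xy` and `uv`: both edges are deleted, and `x` is
joined to `u` and `y` to `v`, with the weight that `xy` had. It is meant for `w₁ x y = w₂ u v`. -/
def glue [DecidableEq V₁] [DecidableEq V₂] (w₁ : V₁ → V₁ → ℕ) (w₂ : V₂ → V₂ → ℕ)
    (x y : V₁) (u v : V₂) : V₁ ⊕ V₂ → V₁ ⊕ V₂ → ℕ
  | .inl a, .inl b => if (a = x ∧ b = y) ∨ (a = y ∧ b = x) then 0 else w₁ a b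
  | .inr a, .inr b => if (a = u ∧ b = v) ∨ (a = v ∧ b = u) then 0 else w₂ a b
  | .inl a, .inr b => if (a = x ∧ b = u) ∨ (a = y ∧ b = v) then w₁ x y else 0
  | .inr b, .inl a => if (a = x ∧ b = u) ∨ (a = y ∧ b = v) then w₁ x y else 0

section glue

variable [DecidableEq V₁] [DecidableEq V₂] {w₁ : V₁ → V₁ → ℕ} {w₂ : V₂ → V₂ → ℕ}
  {x y : V₁} {u v : V₂}

lemma glue_symm (h₁ : ∀ a b, w₁ a b = w₁ b a) (h₂ : ∀ a b, w₂ a b = w₂ b a) (p q : V₁ ⊕ V₂) :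
    glue w₁ w₂ x y u v p q = glue w₁ w₂ x y u v q p := by
  rcases p with a | a <;> rcases q with b | b <;> simp only [glue]
  · rw [h₁ a b]; congr 1; grind
  · rw [h₂ a b]; congr 1; grind

lemma glue_self (h₁ : ∀ a, w₁ a a = 0) (h₂ : ∀ a, w₂ a a = 0) (p : V₁ ⊕ V₂) :
    glue w₁ w₂ x y u v p p = 0 := by
  rcases p with a | a <;> simp [glue, h₁, h₂]

lemma sum_sum_eq_add_of_edge [Fintype V] [DecidableEq V] {w : V → V → ℕ}
    (hw : ∀ a b, w a b = w b a) {x y : V} (hxy : x ≠ y) (P : V → V → Bool) :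
    ∑ a, ∑ b, (if P a b then w a b else 0) =
      (∑ a, ∑ b, if P a b then (if (a = x ∧ b = y) ∨ (a = y ∧ b = x) then 0 else w a b) else 0)
        + (if P x y then w x y else 0) + (if P y x then w x y else 0) := by
  have key : ∀ a b, (if P a b then w a b else 0) =
      (if P a b then (if (a = x ∧ b = y) ∨ (a = y ∧ b = x) then 0 else w a b) else 0)
      + (if a = x then (if b = y then (if P x y then w x y else 0) else 0) else 0)
      + (if a = y then (if b = x then (if P y x then w x y else 0) else 0) else 0) := by
    intro a b
    have := hw x y
    by_cases ha : a = x <;> by_cases hb : b = y <;> by_cases ha' : a = y <;> by_cases hb' : b = x <;>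
      subst_vars <;> simp_all
  rw [Finset.sum_congr rfl fun a _ => Finset.sum_congr rfl fun b _ => key a b]
  simp [Finset.sum_add_distrib]

lemma sum_sum_cross [Fintype V₁] [Fintype V₂] (hxy : x ≠ y) (m : ℕ) (P : V₁ → V₂ → Bool) :
    ∑ a, ∑ b, (if P a b then (if (a = x ∧ b = u) ∨ (a = y ∧ b = v) then m else 0) else 0) =
      (if P x u then m else 0) + (if P y v then m else 0) := by
  have key : ∀ a b, (if P a b then (if (a = x ∧ b = u) ∨ (a = y ∧ b = v) then m else 0) else 0) =
      (if a = x then (if b = u then (if P x u then m else 0) else 0) else 0)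
      + (if a = y then (if b = v then (if P y v then m else 0) else 0) else 0) := by
    intro a b
    by_cases ha : a = x <;> by_cases hb : b = u <;> by_cases ha' : a = y <;> by_cases hb' : b = v <;>
      subst_vars <;> simp_all
  rw [Finset.sum_congr rfl fun a _ => Finset.sum_congr rfl fun b _ => key a b]
  simp [Finset.sum_add_distrib]

lemma cut_glue [Fintype V₁] [Fintype V₂]
    (h₁ : ∀ a b, w₁ a b = w₁ b a) (h₂ : ∀ a b, w₂ a b = w₂ b a) (hxy : x ≠ y) (huv : u ≠ v)
    (hm : w₁ x y = w₂ u v) (S : V₁ ⊕ V₂ → Bool) :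
    cut (glue w₁ w₂ x y u v) S + (if S (.inl x) = S (.inl y) then 0 else w₁ x y)
        + (if S (.inr u) = S (.inr v) then 0 else w₁ x y) =
      cut w₁ (S ∘ .inl) + cut w₂ (S ∘ .inr) + (if S (.inl x) = S (.inr u) then 0 else w₁ x y)
        + (if S (.inl y) = S (.inr v) then 0 else w₁ x y) := by
  have e₁ := sum_sum_eq_add_of_edge h₁ hxy fun a b => S (.inl a) && !S (.inl b)
  have e₂ := sum_sum_eq_add_of_edge h₂ huv fun a b => S (.inr a) && !S (.inr b)
  have e₃ := sum_sum_cross (u := u) (v := v) hxy (w₁ x y) fun a b => S (.inl a) && !S (.inr b)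
  have e₄ := sum_sum_cross (u := u) (v := v) hxy (w₁ x y) fun a b => S (.inr b) && !S (.inl a)
  rw [Finset.sum_comm] at e₄
  simp only [cut, Function.comp, Fintype.sum_sum_type, glue, Finset.sum_add_distrib]
  rw [e₁, e₂, e₃, e₄, ← hm]
  cases S (.inl x) <;> cases S (.inl y) <;> cases S (.inr u) <;> cases S (.inr v) <;> simp <;> omega

lemma sum_glue [Fintype V₁] [Fintype V₂] {r : ℕ}
    (h₁ : ∀ a b, w₁ a b = w₁ b a) (h₂ : ∀ a b, w₂ a b = w₂ b a) (hxy : x ≠ y) (huv : u ≠ v)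
    (hm : w₁ x y = w₂ u v) (hr₁ : ∀ a, ∑ b, w₁ a b = r) (hr₂ : ∀ a, ∑ b, w₂ a b = r)
    (p : V₁ ⊕ V₂) : ∑ q, glue w₁ w₂ x y u v p q = r := by
  have hs₁ := h₁ x y
  have hs₂ := h₂ u v
  rcases p with a | a <;> simp only [Fintype.sum_sum_type, glue]
  · rw [← hr₁ a]
    have key : ∀ b, w₁ a b = (if (a = x ∧ b = y) ∨ (a = y ∧ b = x) then 0 else w₁ a b)
        + ((if b = y then (if a = x then w₁ x y else 0) else 0)
        + (if b = x then (if a = y then w₁ x y else 0) else 0)) := by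
      intro b
      grind
    have key' : ∀ b, (if (a = x ∧ b = u) ∨ (a = y ∧ b = v) then w₁ x y else 0) =
        (if b = u then (if a = x then w₁ x y else 0) else 0)
        + (if b = v then (if a = y then w₁ x y else 0) else 0) := by
      intro b
      grind
    rw [Finset.sum_congr rfl fun b _ => key' b, eq_comm,
      Finset.sum_congr rfl fun b _ => key b]
    simp only [Finset.sum_add_distrib, Finset.sum_ite_eq', Finset.mem_univ, if_true]
  · rw [← hr₂ a, add_comm]
    have key : ∀ b, w₂ a b = (if (a = u ∧ b = v) ∨ (a = v ∧ b = u) then 0 else w₂ a b)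
        + ((if b = v then (if a = u then w₁ x y else 0) else 0)
        + (if b = u then (if a = v then w₁ x y else 0) else 0)) := by
      intro b
      grind
    have key' : ∀ b, (if (b = x ∧ a = u) ∨ (b = y ∧ a = v) then w₁ x y else 0) =
        (if b = x then (if a = u then w₁ x y else 0) else 0)
        + (if b = y then (if a = v then w₁ x y else 0) else 0) := by
      intro b
      grind
    rw [Finset.sum_congr rfl fun b _ => key' b, eq_comm,
      Finset.sum_congr rfl fun b _ => key b]
    simp only [Finset.sum_add_distrib, Finset.sum_ite_eq', Finset.mem_univ, if_true]

end glue

lemma sum_card_filter_eq [Fintype V] [DecidableEq V] [Fintype ι] (f : ι → V) :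
    ∑ b, (Finset.univ.filter fun j => f j = b).card = Fintype.card ι := by
  rw [← Finset.card_univ]
  exact (Finset.card_eq_sum_card_fiberwise fun _ _ => Finset.mem_coe.2 (Finset.mem_univ _)).symm

lemma IsPacking.pos [DecidableEq V] [Fintype ι] {w : V → V → ℕ} {F : ι → V → V}
    (hF : IsPacking w F) (j : ι) (a : V) : 0 < w a (F j a) :=
  lt_of_lt_of_le (Finset.card_pos.2 ⟨j, by simp⟩) (hF.card_le a (F j a))

lemma odd_card_of_involutive_of_unique_fixed [Fintype V] {f : V → V} (hf : ∀ a, f (f a) = a)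
    {u : V} (hu : ∀ a, f a = a ↔ a = u) : Odd (Fintype.card V) := by
  classical
  have h := Equiv.Perm.card_fixedPoints_modEq (f := (f : Function.End V)) (p := 2) (n := 1)
    (funext fun a => hf a)
  have : Fintype.card (Function.fixedPoints f) = 1 := by
    rw [Fintype.card_eq_one_iff]
    refine ⟨⟨u, (hu u).2 rfl⟩, fun b => Subtype.ext ((hu b.1).1 b.2)⟩
  rw [Nat.odd_iff]
  rw [this] at h
  exact h

/-- Since the second side has an even number of vertices, a perfect matching of the gluing uses
either both or none of the two kinds of connecting edges. -/
lemma IsPacking.glue_cross_iff [Fintype V₂] [DecidableEq V₁] [DecidableEq V₂] [Fintype ι]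
    {w₁ : V₁ → V₁ → ℕ} {w₂ : V₂ → V₂ → ℕ} {x y : V₁} {u v : V₂} (hxy : x ≠ y) (huv : u ≠ v)
    (hl₂ : ∀ a, w₂ a a = 0)
    {F : ι → V₁ ⊕ V₂ → V₁ ⊕ V₂} (hF : IsPacking (glue w₁ w₂ x y u v) F)
    (heven : Even (Fintype.card V₂)) (j : ι) :
    F j (.inl x) = .inr u ↔ F j (.inl y) = .inr v := by
  have cross : ∀ g a, F j (.inr g) = .inl a → (a = x ∧ g = u) ∨ (a = y ∧ g = v) := by
    intro g a h
    have := hF.pos j (.inr g)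
    rw [h] at this
    by_contra hc
    simp [glue, hc] at this
  by_contra hne
  obtain ⟨c, hc⟩ : ∃ c, ∀ g, (∃ a, F j (.inr g) = .inl a) ↔ g = c := by
    have i₁ : F j (.inl x) = .inr u ↔ F j (.inr u) = .inl x :=
      ⟨fun h => by rw [← h, hF.invol], fun h => by rw [← h, hF.invol]⟩
    have i₂ : F j (.inl y) = .inr v ↔ F j (.inr v) = .inl y :=
      ⟨fun h => by rw [← h, hF.invol], fun h => by rw [← h, hF.invol]⟩
    rw [i₁, i₂] at hne
    by_cases hu : F j (.inr u) = .inl x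
    · refine ⟨u, fun g => ⟨?_, ?_⟩⟩
      · rintro ⟨a, h⟩
        rcases cross g a h with ⟨rfl, rfl⟩ | ⟨rfl, rfl⟩
        · rfl
        · exact absurd (iff_of_true hu h) hne
      · rintro rfl
        exact ⟨x, hu⟩
    · have hv : F j (.inr v) = .inl y := by tauto
      refine ⟨v, fun g => ⟨?_, ?_⟩⟩
      · rintro ⟨a, h⟩
        rcases cross g a h with ⟨rfl, rfl⟩ | ⟨rfl, rfl⟩
        · exact absurd h hu
        · rfl
      · rintro rfl
        exact ⟨y, hv⟩
  let f : V₂ → V₂ := fun g => (F j (.inr g)).elim (fun _ => g) id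
  refine (Nat.not_odd_iff_even.2 heven) (odd_card_of_involutive_of_unique_fixed (f := f) (u := c) ?_ ?_)
  · intro g
    rcases h : F j (.inr g) with a | h'
    · simp [f, h]
    · have : F j (.inr h') = .inr g := by rw [← h, hF.invol]
      simp [f, h, this]
  · intro g
    rw [← hc g]
    rcases h : F j (.inr g) with a | h'
    · simp [f, h]
    · simp only [f, h, Sum.elim_inr, id, reduceCtorEq, exists_false, iff_false]
      rintro rfl
      have := hF.pos j (.inr h')
      rw [h] at this
      simp [glue, hl₂] at this

/-- Every packing of a gluing restricts to packings of both sides: a matching that crosses between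
the sides is completed by the deleted edge on each of them. -/
lemma IsPacking.of_glue [Fintype V₂] [DecidableEq V₁] [DecidableEq V₂] [Fintype ι]
    {w₁ : V₁ → V₁ → ℕ} {w₂ : V₂ → V₂ → ℕ} {x y : V₁} {u v : V₂}
    (h₁ : ∀ a b, w₁ a b = w₁ b a) (h₂ : ∀ a b, w₂ a b = w₂ b a) (hxy : x ≠ y) (huv : u ≠ v)
    (hl₂ : ∀ a, w₂ a a = 0) (hm : w₁ x y = w₂ u v)
    {F : ι → V₁ ⊕ V₂ → V₁ ⊕ V₂} (hF : IsPacking (glue w₁ w₂ x y u v) F)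
    (heven : Even (Fintype.card V₂)) :
    ∃ (F₁ : ι → V₁ → V₁) (F₂ : ι → V₂ → V₂), IsPacking w₁ F₁ ∧ IsPacking w₂ F₂ ∧
      (∀ j, F₁ j x = y ↔ F₂ j u = v) ∧
      ∀ j a b, ¬ (a = x ∧ b = y) → ¬ (a = y ∧ b = x) →
        (F₁ j a = b ↔ F j (.inl a) = .inl b) := by
  have crossl : ∀ j a g, F j (.inl a) = .inr g → (a = x ∧ g = u) ∨ (a = y ∧ g = v) := by
    intro j a g h
    have := hF.pos j (.inl a)
    rw [h] at this
    by_contra hc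
    simp [glue, hc] at this
  have flip : ∀ j p q, F j p = q → F j q = p := by
    rintro j p q rfl; exact hF.invol j p
  have iff := hF.glue_cross_iff hxy huv hl₂ heven
  have nl : ∀ j, F j (.inl x) ≠ .inl y := by
    intro j h
    have := hF.pos j (.inl x)
    simp [h, glue] at this
  have nr : ∀ j, F j (.inr u) ≠ .inr v := by
    intro j h
    have := hF.pos j (.inr u)
    simp [h, glue] at this
  let F₁ : ι → V₁ → V₁ := fun j a => (F j (.inl a)).elim id (fun _ => if a = x then y else x)
  let F₂ : ι → V₂ → V₂ := fun j g => (F j (.inr g)).elim (fun _ => if g = u then v else u) id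
  have l₁ : ∀ j a b, F j (.inl a) = .inl b → F₁ j a = b := fun j a b h => by simp [F₁, h]
  have l₂ : ∀ j a b, F j (.inr a) = .inr b → F₂ j a = b := fun j a b h => by simp [F₂, h]
  have c₁ : ∀ j, F j (.inl x) = .inr u → F₁ j x = y ∧ F₁ j y = x ∧ F₂ j u = v ∧ F₂ j v = u := by
    intro j h
    have h' := (iff j).1 h
    simp [F₁, F₂, h, h', flip _ _ _ h, flip _ _ _ h', hxy.symm, huv.symm]
  -- outside the two deleted edges the restrictions agree with `F`
  have m₁ : ∀ j a b, ¬ (a = x ∧ b = y) → ¬ (a = y ∧ b = x) →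
      (F₁ j a = b ↔ F j (.inl a) = .inl b) := by
    intro j a b n₁ n₂
    refine ⟨fun h => ?_, l₁ j a b⟩
    rcases hc : F j (.inl a) with b' | g
    · rw [l₁ j a b' hc] at h; rw [h]
    · rcases crossl j a g hc with ⟨rfl, rfl⟩ | ⟨rfl, rfl⟩
      · exact absurd ⟨rfl, h ▸ (c₁ j hc).1⟩ n₁
      · exact absurd ⟨rfl, h ▸ (c₁ j ((iff j).2 hc)).2.1⟩ n₂
  have m₂ : ∀ j a b, ¬ (a = u ∧ b = v) → ¬ (a = v ∧ b = u) →
      (F₂ j a = b ↔ F j (.inr a) = .inr b) := by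
    intro j a b n₁ n₂
    refine ⟨fun h => ?_, l₂ j a b⟩
    rcases hc : F j (.inr a) with b' | g
    · rcases crossl j b' a (flip _ _ _ hc) with ⟨rfl, rfl⟩ | ⟨rfl, rfl⟩
      · exact absurd ⟨rfl, h ▸ (c₁ j (flip _ _ _ hc)).2.2.1⟩ n₁
      · exact absurd ⟨rfl, h ▸ (c₁ j ((iff j).2 (flip _ _ _ hc))).2.2.2⟩ n₂
    · rw [l₂ j a g hc] at h; rw [h]
  have inv₁ : ∀ j a, F₁ j (F₁ j a) = a := by
    intro j a
    rcases hc : F j (.inl a) with b | g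
    · rw [l₁ j a b hc, l₁ j b a (flip _ _ _ hc)]
    · rcases crossl j a g hc with ⟨rfl, rfl⟩ | ⟨rfl, rfl⟩
      · rw [(c₁ j hc).1, (c₁ j hc).2.1]
      · have := c₁ j ((iff j).2 hc)
        rw [this.2.1, this.1]
  have inv₂ : ∀ j a, F₂ j (F₂ j a) = a := by
    intro j a
    rcases hc : F j (.inr a) with b | g
    · rcases crossl j b a (flip _ _ _ hc) with ⟨rfl, rfl⟩ | ⟨rfl, rfl⟩
      · have := c₁ j (flip _ _ _ hc)
        rw [this.2.2.1, this.2.2.2]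
      · have := c₁ j ((iff j).2 (flip _ _ _ hc))
        rw [this.2.2.2, this.2.2.1]
    · rw [l₂ j a g hc, l₂ j g a (flip _ _ _ hc)]
  have e₁ : ∀ j, F₁ j x = y ↔ F j (.inl x) = .inr u := by
    intro j
    refine ⟨fun h => ?_, fun h => (c₁ j h).1⟩
    rcases hc : F j (.inl x) with b | g
    · rw [l₁ j x b hc] at h; exact absurd (h ▸ hc) (nl j)
    · rcases crossl j x g hc with ⟨-, rfl⟩ | ⟨h', -⟩
      · rfl
      · exact absurd h' hxy
  have e₂ : ∀ j, F₂ j u = v ↔ F j (.inl x) = .inr u := by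
    intro j
    refine ⟨fun h => ?_, fun h => (c₁ j h).2.2.1⟩
    rcases hc : F j (.inr u) with b | g
    · rcases crossl j b u (flip _ _ _ hc) with ⟨rfl, -⟩ | ⟨-, h'⟩
      · exact flip _ _ _ hc
      · exact absurd h' huv
    · rw [l₂ j u g hc] at h; exact absurd (h ▸ hc) (nr j)
  have sw₁ : ∀ j, F₁ j y = x ↔ F₁ j x = y := fun j =>
    ⟨fun h => by rw [← h, inv₁], fun h => by rw [← h, inv₁]⟩
  have sw₂ : ∀ j, F₂ j v = u ↔ F₂ j u = v := fun j =>
    ⟨fun h => by rw [← h, inv₂], fun h => by rw [← h, inv₂]⟩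
  have hcard : (Finset.univ.filter fun j => F j (.inl x) = .inr u).card ≤ w₁ x y := by
    simpa [glue] using hF.card_le (.inl x) (.inr u)
  refine ⟨F₁, F₂, ⟨inv₁, fun a b => ?_⟩, ⟨inv₂, fun a b => ?_⟩, fun j => (e₁ j).trans (e₂ j).symm, m₁⟩
  · by_cases n₁ : a = x ∧ b = y
    · obtain ⟨rfl, rfl⟩ := n₁
      simpa only [e₁] using hcard
    by_cases n₂ : a = y ∧ b = x
    · obtain ⟨rfl, rfl⟩ := n₂
      rw [h₁]
      simpa only [sw₁, e₁] using hcard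
    simp only [m₁ _ a b n₁ n₂]
    simpa [glue, n₁, n₂] using hF.card_le (.inl a) (.inl b)
  · by_cases n₁ : a = u ∧ b = v
    · obtain ⟨rfl, rfl⟩ := n₁
      rw [← hm]
      simpa only [e₂] using hcard
    by_cases n₂ : a = v ∧ b = u
    · obtain ⟨rfl, rfl⟩ := n₂
      rw [h₂, ← hm]
      simpa only [sw₂, e₂] using hcard
    simp only [m₂ _ a b n₁ n₂]
    simpa [glue, n₁, n₂] using hF.card_le (.inr a) (.inr b)

/-! ### The Petersen gadget -/

/-- The six perfect matchings of the Petersen graph, as involutions. Every edge lies in exactly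
two of them and any two share exactly one edge; matchings `0` and `1` share the edge `01`. -/
def petersenMatching : Fin 6 → Fin 10 → Fin 10 :=
  ![![1, 0, 3, 2, 9, 7, 8, 5, 6, 4], ![1, 0, 7, 4, 3, 8, 9, 2, 5, 6],
    ![4, 2, 1, 8, 0, 7, 9, 5, 3, 6], ![4, 6, 3, 2, 0, 8, 1, 9, 5, 7],
    ![5, 2, 1, 4, 3, 0, 8, 9, 6, 7], ![5, 6, 7, 8, 9, 0, 1, 2, 3, 4]]

/-- The Petersen graph, with `n i` further copies of its `i`-th perfect matching. -/
def gadget (n : Fin 6 → ℕ) (a b : Fin 10) : ℕ :=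
  (if ∃ i, petersenMatching i a = b then 1 else 0) +
    ∑ i, if petersenMatching i a = b then n i else 0

lemma petersenMatching_invol :
    ∀ i a, petersenMatching i (petersenMatching i a) = a := by decide

lemma petersenMatching_eq_comm (i : Fin 6) (a b : Fin 10) :
    petersenMatching i a = b ↔ petersenMatching i b = a :=
  ⟨fun h => by rw [← h, petersenMatching_invol], fun h => by rw [← h, petersenMatching_invol]⟩

lemma gadget_symm (n : Fin 6 → ℕ) (a b : Fin 10) : gadget n a b = gadget n b a := by
  simp only [gadget, petersenMatching_eq_comm _ a b]

lemma gadget_self (n : Fin 6 → ℕ) (a : Fin 10) : gadget n a a = 0 := by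
  have : ∀ i a, petersenMatching i a ≠ a := by decide
  simp [gadget, this]

lemma gadget_zero_one (n : Fin 6 → ℕ) : gadget n 0 1 = 1 + n 0 + n 1 := by
  simp [gadget, petersenMatching, Fin.sum_univ_succ, Fin.exists_fin_succ]
  omega

lemma sum_gadget (n : Fin 6 → ℕ) (a : Fin 10) : ∑ b, gadget n a b = ∑ i, n i + 3 := by
  have h : ∀ a, ∑ b : Fin 10, (if ∃ i, petersenMatching i a = b then 1 else 0) = 3 := by
    decide +kernel
  simp only [gadget, Finset.sum_add_distrib, h]
  rw [Finset.sum_comm]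
  simp [add_comm]

/-- The number of edges of the `i`-th perfect matching that leave `S`. -/
def crossing (i : Fin 6) (S : Fin 10 → Bool) : ℕ :=
  ∑ a, if S a && !S (petersenMatching i a) then 1 else 0

lemma two_mul_cut_gadget (n : Fin 6 → ℕ) (S : Fin 10 → Bool) :
    2 * cut (gadget n) S = ∑ i, (2 * n i + 1) * crossing i S := by
  have h : ∀ a b : Fin 10, 2 * (if ∃ i, petersenMatching i a = b then 1 else 0) =
      ∑ i, if petersenMatching i a = b then 1 else 0 := by decide +kernel
  have h' : ∀ a b, 2 * gadget n a b =
      ∑ i, if petersenMatching i a = b then 2 * n i + 1 else 0 := by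
    intro a b
    rw [gadget, mul_add, h, Finset.mul_sum, ← Finset.sum_add_distrib]
    refine Finset.sum_congr rfl fun i _ => ?_
    split_ifs <;> ring
  calc 2 * cut (gadget n) S
      = ∑ a, ∑ b, ∑ i, if b = petersenMatching i a then
          (if S a && !S b then 2 * n i + 1 else 0) else 0 := by
        simp only [cut, Finset.mul_sum]
        refine Finset.sum_congr rfl fun a _ => Finset.sum_congr rfl fun b _ => ?_
        rw [mul_ite, h', mul_zero]
        by_cases hS : (S a && !S b) = true <;> simp [hS, eq_comm]
    _ = ∑ a, ∑ i, if S a && !S (petersenMatching i a) then 2 * n i + 1 else 0 := by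
        refine Finset.sum_congr rfl fun a _ => ?_
        rw [Finset.sum_comm]
        simp
    _ = _ := by
        rw [Finset.sum_comm]
        refine Finset.sum_congr rfl fun i _ => ?_
        rw [crossing, Finset.mul_sum]
        simp

lemma forall_fin_ten_bool {P : (Fin 10 → Bool) → Prop}
    (h : ∀ b0 b1 b2 b3 b4 b5 b6 b7 b8 b9, P ![b0, b1, b2, b3, b4, b5, b6, b7, b8, b9])
    (S : Fin 10 → Bool) : P S := by
  have : S = ![S 0, S 1, S 2, S 3, S 4, S 5, S 6, S 7, S 8, S 9] := by
    funext i; fin_cases i <;> rfl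
  rw [this]
  exact h ..

lemma one_le_crossing (S : Fin 10 → Bool) : size S % 2 = 1 → ∀ i, 1 ≤ crossing i S := by
  refine forall_fin_ten_bool (P := fun S => size S % 2 = 1 → ∀ i, 1 ≤ crossing i S) ?_ S
  decide +kernel

/-- All but at most two of the matchings leave a nontrivial even set at least twice: only the common
edge of two matchings, or its complement, is left by neither of the two. If that set separates `0`
from `1`, the exceptional matchings avoid the edge `01`. -/
lemma two_le_crossing (S : Fin 10 → Bool) : size S % 2 = 0 → size S ≠ 0 → size S ≠ 10 →
    ∃ i j, i ≠ j ∧ (S 0 ≠ S 1 → 2 ≤ i ∧ 2 ≤ j) ∧ ∀ k, k ≠ i → k ≠ j → 2 ≤ crossing k S := by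
  refine forall_fin_ten_bool (P := fun S => size S % 2 = 0 → size S ≠ 0 → size S ≠ 10 →
    ∃ i j, i ≠ j ∧ (S 0 ≠ S 1 → 2 ≤ i ∧ 2 ≤ j) ∧ ∀ k, k ≠ i → k ≠ j → 2 ≤ crossing k S) ?_ S
  decide +kernel

lemma le_cut_gadget_of_odd (n : Fin 6 → ℕ) (S : Fin 10 → Bool) (hS : size S % 2 = 1) :
    ∑ i, n i + 3 ≤ cut (gadget n) S := by
  have h : ∑ i, (2 * n i + 1) ≤ 2 * cut (gadget n) S := by
    rw [two_mul_cut_gadget]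
    exact Finset.sum_le_sum fun i _ => Nat.le_mul_of_pos_right _ (one_le_crossing S hS i)
  rw [Finset.sum_add_distrib, ← Finset.mul_sum] at h
  simp at h
  omega

lemma le_cut_gadget_of_even (n : Fin 6 → ℕ) (S : Fin 10 → Bool) (hS : size S % 2 = 0)
    (h0 : size S ≠ 0) (h10 : size S ≠ 10) : ∃ i j, i ≠ j ∧ (S 0 ≠ S 1 → 2 ≤ i ∧ 2 ≤ j) ∧
      2 * ∑ i, n i + 4 ≤ cut (gadget n) S + 2 * (n i + n j) := by
  obtain ⟨i, j, hij, hs, hk⟩ := two_le_crossing S hS h0 h10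
  refine ⟨i, j, hij, hs, ?_⟩
  have h : ∑ k, (2 * n k + 1) * 2 ≤ ∑ k, ((2 * n k + 1) * crossing k S
      + ((if k = i then (2 * n k + 1) * 2 else 0) + (if k = j then (2 * n k + 1) * 2 else 0))) := by
    refine Finset.sum_le_sum fun k _ => ?_
    by_cases hi : k = i
    · simp [hi]; omega
    by_cases hj : k = j
    · simp [hj]; omega
    have := Nat.mul_le_mul_left (2 * n k + 1) (hk k hi hj)
    omega
  rw [Finset.sum_add_distrib, ← two_mul_cut_gadget, ← Finset.sum_mul, Finset.sum_add_distrib,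
    ← Finset.mul_sum, Finset.sum_add_distrib] at h
  simp at h
  omega

set_option synthInstance.maxSize 10000 in
set_option synthInstance.maxHeartbeats 1000000 in
/-- The six matchings are the only ones: the vertices choose their partners among their neighbours
one after the other, and each new choice has to agree with the earlier ones. -/
lemma eq_petersenMatching_aux :
    ∀ a0 ∈ ([1, 4, 5] : List (Fin 10)), ∀ a1 ∈ ([0, 2, 6] : List (Fin 10)), (a0 = 1 ↔ a1 = 0) →
    ∀ a2 ∈ ([1, 3, 7] : List (Fin 10)), (a1 = 2 ↔ a2 = 1) →
    ∀ a3 ∈ ([2, 4, 8] : List (Fin 10)), (a2 = 3 ↔ a3 = 2) →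
    ∀ a4 ∈ ([3, 0, 9] : List (Fin 10)), (a3 = 4 ↔ a4 = 3) → (a0 = 4 ↔ a4 = 0) →
    ∀ a5 ∈ ([0, 7, 8] : List (Fin 10)), (a0 = 5 ↔ a5 = 0) →
    ∀ a6 ∈ ([1, 8, 9] : List (Fin 10)), (a1 = 6 ↔ a6 = 1) →
    ∀ a7 ∈ ([2, 9, 5] : List (Fin 10)), (a2 = 7 ↔ a7 = 2) → (a5 = 7 ↔ a7 = 5) →
    ∀ a8 ∈ ([3, 5, 6] : List (Fin 10)), (a3 = 8 ↔ a8 = 3) → (a5 = 8 ↔ a8 = 5) → (a6 = 8 ↔ a8 = 6) →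
    ∀ a9 ∈ ([4, 6, 7] : List (Fin 10)), (a4 = 9 ↔ a9 = 4) → (a6 = 9 ↔ a9 = 6) → (a7 = 9 ↔ a9 = 7) →
    ∃ i, petersenMatching i = ![a0, a1, a2, a3, a4, a5, a6, a7, a8, a9] := by
  decide +kernel

lemma exists_eq_petersenMatching (f : Fin 10 → Fin 10) (hf : ∀ a, f (f a) = a)
    (hadj : ∀ a, ∃ i, petersenMatching i a = f a) : ∃ i, petersenMatching i = f := by
  have hc : ∀ a b, f a = b ↔ f b = a := fun a b =>
    ⟨fun h => by rw [← h, hf], fun h => by rw [← h, hf]⟩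
  have hN : ∀ a b, (∃ i, petersenMatching i a = b) → b ∈
      (![[1, 4, 5], [0, 2, 6], [1, 3, 7], [2, 4, 8], [3, 0, 9], [0, 7, 8], [1, 8, 9], [2, 9, 5],
        [3, 5, 6], [4, 6, 7]] : Fin 10 → List (Fin 10)) a := by decide +kernel
  have m := fun a => hN a _ (hadj a)
  obtain ⟨i, hi⟩ := eq_petersenMatching_aux (f 0) (m 0) (f 1) (m 1) (hc _ _) (f 2) (m 2) (hc _ _)
    (f 3) (m 3) (hc _ _) (f 4) (m 4) (hc _ _) (hc _ _) (f 5) (m 5) (hc _ _) (f 6) (m 6) (hc _ _)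
    (f 7) (m 7) (hc _ _) (hc _ _) (f 8) (m 8) (hc _ _) (hc _ _) (hc _ _)
    (f 9) (m 9) (hc _ _) (hc _ _) (hc _ _)
  refine ⟨i, hi.trans ?_⟩
  funext a; fin_cases a <;> rfl

/-- A packing with one matching more than the `∑ i, n i` added ones uses the edge `01` at least
`n 0 + n 1` times, that is, leaves at most one of its parallel copies uncovered. -/
lemma IsPacking.le_card_gadget {ι : Type*} [Fintype ι] (n : Fin 6 → ℕ)
    {F : ι → Fin 10 → Fin 10} (hF : IsPacking (gadget n) F)
    (hι : Fintype.card ι = ∑ i, n i + 1) :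
    n 0 + n 1 ≤ (Finset.univ.filter fun j => F j 0 = 1).card := by
  classical
  have hτ : ∀ j, ∃ i, petersenMatching i = F j := by
    intro j
    refine exists_eq_petersenMatching (F j) (hF.invol j) fun a => ?_
    have := hF.pos j a
    by_contra hne
    have hne' : ∀ i, petersenMatching i a ≠ F j a := fun i hi => hne ⟨i, hi⟩
    simp [gadget, hne'] at this
  choose τ hτ using hτ
  let c : Fin 6 → ℕ := fun i => (Finset.univ.filter fun j => τ j = i).card
  have hsum : ∑ i, c i = ∑ i, n i + 1 := by
    rw [← hι]
    exact sum_card_filter_eq τ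
  have hle : ∀ i i' x, i ≠ i' → petersenMatching i x = petersenMatching i' x →
      c i + c i' ≤ (Finset.univ.filter fun j => F j x = petersenMatching i x).card := by
    intro i i' x hne hx
    rw [← Finset.card_union_of_disjoint]
    · refine Finset.card_le_card fun j hj => ?_
      simp only [Finset.mem_union, Finset.mem_filter, Finset.mem_univ, true_and] at hj ⊢
      rw [← hτ]
      rcases hj with h | h
      · rw [h]
      · rw [h, hx]
    · rw [Finset.disjoint_left]
      intro j h h'
      simp only [Finset.mem_filter, Finset.mem_univ, true_and] at h h'
      exact hne (h.symm.trans h')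
  have hpair : ∀ i i', i ≠ i' → ∃ x, petersenMatching i x = petersenMatching i' x ∧
      ∀ k, petersenMatching k x = petersenMatching i x → k = i ∨ k = i' := by decide +kernel
  have hub : ∀ i i', i ≠ i' → c i + c i' ≤ 1 + n i + n i' := by
    intro i i' hne
    obtain ⟨x, hx, hk⟩ := hpair i i' hne
    refine (hle i i' x hne hx).trans ((hF.card_le _ _).trans ?_)
    have : ∑ k, (if petersenMatching k x = petersenMatching i x then n k else 0) ≤
        ∑ k, ((if k = i then n k else 0) + (if k = i' then n k else 0)) := by
      refine Finset.sum_le_sum fun k _ => ?_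
      have := hk k
      split_ifs <;> simp_all
    rw [Finset.sum_add_distrib] at this
    simp at this
    simp only [gadget]
    split_ifs <;> omega
  refine le_trans ?_ (hle 0 1 0 (by decide) (by decide))
  -- Writing `b i = n i - c i`, these say `b i + b i' ≥ -1`, while `∑ i, b i = -1`. If
  -- `b 0 + b 1 ≥ 1`, then all sums of two of the other four would be `-1`, which parity forbids.
  have := hub 0 1 (by decide); have := hub 2 3 (by decide); have := hub 4 5 (by decide)
  have := hub 2 4 (by decide); have := hub 3 5 (by decide); have := hub 2 5 (by decide)
  have := hub 3 4 (by decide)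
  simp only [Fin.sum_univ_six] at hsum
  omega

/-! ### Substituting a gadget for an edge -/

lemma size_eq_zero_iff [Fintype V] (S : V → Bool) : size S = 0 ↔ ∀ a, S a = false := by
  simp [size, Finset.sum_eq_zero_iff]

lemma size_eq_card_iff [Fintype V] (S : V → Bool) : size S = Fintype.card V ↔ ∀ a, S a = true := by
  have h := Finset.sum_eq_sum_iff_of_le (s := Finset.univ) (f := fun a => (S a).toNat)
    (g := fun _ : V => 1) (fun a _ => Bool.toNat_le (S a))
  simpa [size] using h

lemma size_sum [Fintype V₁] [Fintype V₂] (S : V₁ ⊕ V₂ → Bool) :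
    size S = size (S ∘ .inl) + size (S ∘ .inr) := by
  simp [size, Fintype.sum_sum_type]

lemma cut_of_const [Fintype V] (w : V → V → ℕ) {S : V → Bool} {b : Bool} (h : ∀ a, S a = b) :
    cut w S = 0 := by
  cases b <;> simp [cut, h]

/-- Cuts of a gluing are at least the sum of the two induced cuts, unless they separate the ends of
both deleted edges without separating those of the connecting edges. -/
lemma cut_glue_cases [Fintype V₁] [Fintype V₂] [DecidableEq V₁] [DecidableEq V₂]
    {w₁ : V₁ → V₁ → ℕ} {w₂ : V₂ → V₂ → ℕ} {x y : V₁} {u v : V₂}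
    (h₁ : ∀ a b, w₁ a b = w₁ b a) (h₂ : ∀ a b, w₂ a b = w₂ b a) (hxy : x ≠ y) (huv : u ≠ v)
    (hm : w₁ x y = w₂ u v) (S : V₁ ⊕ V₂ → Bool) :
    (S (.inl x) = S (.inl y) → S (.inr u) = S (.inr v) → S (.inl x) ≠ S (.inr u) →
      2 * w₁ x y ≤ cut (glue w₁ w₂ x y u v) S) ∧
    (cut w₁ (S ∘ .inl) + cut w₂ (S ∘ .inr) ≤ cut (glue w₁ w₂ x y u v) S ∨
      (S (.inl x) ≠ S (.inl y) ∧ S (.inr u) ≠ S (.inr v) ∧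
        cut (glue w₁ w₂ x y u v) S + 2 * w₁ x y = cut w₁ (S ∘ .inl) + cut w₂ (S ∘ .inr))) := by
  have key := cut_glue h₁ h₂ hxy huv hm S
  revert key
  generalize cut (glue w₁ w₂ x y u v) S = d
  cases S (.inl x) <;> cases S (.inl y) <;> cases S (.inr u) <;> cases S (.inr v) <;>
    simp <;> omega

/-- The invariant of the construction. The weights describe an `r`-regular multigraph of even order
with all cuts at least `t`, and at least `r` for odd sets, in which `D` is a list of edges still to
be substituted. A marked edge is heavy if its weight exceeds `r / 2`. In `le_cut`, the number `j`
ranges over the possible numbers of separated heavy marked edges whose substitution flips the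
parity of the set; each of them lowers the cut by up to `r - t`. Finally, every packing of `r - 2`
perfect matchings leaves at least two copies of some marked edge uncovered. -/
structure IsGood (r t : ℕ) [Fintype V] [DecidableEq V] (w : V → V → ℕ) (D : List (V × V)) :
    Prop where
  symm : ∀ a b, w a b = w b a
  self : ∀ a, w a a = 0
  reg : ∀ a, ∑ b, w a b = r
  even : Even (Fintype.card V)
  le_cut : ∀ S : V → Bool, size S ≠ 0 → size S ≠ Fintype.card V →
    ∀ j ≤ D.countP (fun e => S e.1 != S e.2 && decide (r < 2 * w e.1 e.2)),
      (r - t) * j + (if (size S + j) % 2 = 0 then t else r) ≤ cut w S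
  ne : ∀ e ∈ D, e.1 ≠ e.2
  weight : ∀ e ∈ D, 2 * w e.1 e.2 = t ∨ 2 * w e.1 e.2 = 2 * r - t
  distinct : D.Pairwise fun e f => ¬ (f.1 = e.1 ∧ f.2 = e.2) ∧ ¬ (f.1 = e.2 ∧ f.2 = e.1)
  no_packing : ∀ F : Fin (r - 2) → V → V, IsPacking w F →
    ∃ e ∈ D, (Finset.univ.filter fun j => F j e.1 = e.2).card + 1 < w e.1 e.2

/-- The added matchings of a gadget whose edge `01` has weight `m`: `m - 1` copies are shared evenly
between the matchings `0` and `1` through this edge, the others between the matchings `2` and `3`.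
The two last conditions bound the weights of all edges, and of the edges lying in neither of the
matchings `0` and `1`. -/
lemma exists_gadget {r t m : ℕ} (ht : t % 2 = 0) (h4 : 4 ≤ t) (htr : t ≤ r) (hrt : r ≤ t + 2)
    (hm : 2 * m = t ∨ 2 * m = 2 * r - t) :
    ∃ n : Fin 6 → ℕ, ∑ i, n i + 3 = r ∧ 1 + n 0 + n 1 = m ∧
      (∀ i j, i ≠ j → 2 * (n i + n j) + 2 + t ≤ 2 * r) ∧
      (∀ i j, i ≠ j → 2 ≤ i → 2 ≤ j → n i + n j + m + 2 ≤ r) := by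
  refine ⟨![m / 2, m - 1 - m / 2, (r - m - 2) / 2, r - m - 2 - (r - m - 2) / 2, 0, 0],
    ?_, ?_, ?_, ?_⟩
  · simp [Fin.sum_univ_succ]; omega
  · simp; omega
  · simp only [Fin.forall_fin_succ]; simp; omega
  · simp only [Fin.forall_fin_succ]; simp; omega

set_option maxHeartbeats 1000000 in
/-- Gluing in a gadget at the first marked edge removes it from the list: the gadget forces every
packing to leave at most one copy of that edge uncovered. -/
lemma IsGood.substitute {r t : ℕ} (ht : t % 2 = 0) (h4 : 4 ≤ t) (htr : t ≤ r) (hrt : r ≤ t + 2)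
    [Fintype V] [DecidableEq V] {w : V → V → ℕ} {x y : V} {D : List (V × V)}
    (h : IsGood r t w ((x, y) :: D)) :
    ∃ n : Fin 6 → ℕ, IsGood r t (glue w (gadget n) x y 0 1)
      (D.map fun e => (Sum.inl e.1, Sum.inl e.2)) := by
  have hxy : x ≠ y := h.ne _ List.mem_cons_self
  have hmw := h.weight _ List.mem_cons_self
  simp only at hmw
  obtain ⟨n, hn, hn01, hnt, hnm⟩ := exists_gadget ht h4 htr hrt hmw
  have h01 : (0 : Fin 10) ≠ 1 := by decide
  have hw01 : w x y = gadget n 0 1 := by rw [gadget_zero_one, hn01]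
  have hD : ∀ e ∈ D, ¬ (e.1 = x ∧ e.2 = y) ∧ ¬ (e.1 = y ∧ e.2 = x) :=
    (List.pairwise_cons.1 h.distinct).1
  have hwD : ∀ e ∈ D, glue w (gadget n) x y 0 1 (.inl e.1) (.inl e.2) = w e.1 e.2 := by
    intro e he
    simp [glue, hD e he]
  have hodd : ∀ S, size S % 2 = 1 → r ≤ cut (gadget n) S := fun S hS =>
    hn ▸ le_cut_gadget_of_odd n S hS
  have hev : ∀ S, size S % 2 = 0 → size S ≠ 0 → size S ≠ 10 →
      t ≤ cut (gadget n) S ∧ (S 0 ≠ S 1 → 2 * w x y ≤ cut (gadget n) S) := by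
    intro S hS h0 h10
    obtain ⟨i, j, hij, hs, hc⟩ := le_cut_gadget_of_even n S hS h0 h10
    refine ⟨?_, fun hS' => ?_⟩
    · have := hnt i j hij; omega
    · have := hnm i j hij (hs hS').1 (hs hS').2; omega
  refine ⟨n, glue_symm h.symm (gadget_symm n), glue_self h.self (gadget_self n), ?_, ?_, ?_, ?_,
    ?_, ?_, ?_⟩
  · exact sum_glue h.symm (gadget_symm n) hxy h01 hw01 h.reg
      (fun a => by rw [sum_gadget, hn])
  · rw [Fintype.card_sum]
    exact h.even.add (by decide)
  · intro S hS0 hS1 j hj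
    obtain ⟨key₁, key₂⟩ := cut_glue_cases h.symm (gadget_symm n) hxy h01 hw01 S
    have hcount : (D.map fun e => ((Sum.inl e.1, Sum.inl e.2) : (V ⊕ Fin 10) × (V ⊕ Fin 10))).countP
        (fun e => S e.1 != S e.2 && decide (r < 2 * glue w (gadget n) x y 0 1 e.1 e.2)) =
        D.countP (fun e => (S ∘ .inl) e.1 != (S ∘ .inl) e.2 && decide (r < 2 * w e.1 e.2)) := by
      rw [List.countP_map]
      refine List.countP_congr fun e he => ?_
      simp [hwD e he]
    rw [hcount] at hj
    have hcut := h.le_cut (S ∘ .inl)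
    rw [List.countP_cons] at hcut
    have hodd := hodd (S ∘ .inr)
    have hev := hev (S ∘ .inr)
    have hz₁ := size_eq_zero_iff (S ∘ .inl)
    have hc₁ := size_eq_card_iff (S ∘ .inl)
    have hz₂ := size_eq_zero_iff (S ∘ .inr)
    have hc₂ := size_eq_card_iff (S ∘ .inr)
    rw [size_sum] at hS0 hS1 ⊢
    rw [Fintype.card_sum] at hS1
    have hVe := Nat.even_iff.1 h.even
    simp only [Fintype.card_fin] at hS1 hc₂
    generalize cut (glue w (gadget n) x y 0 1) S = d at *
    by_cases triv₁ : size (S ∘ .inl) = 0 ∨ size (S ∘ .inl) = Fintype.card V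
    · have hb : ∃ b, ∀ a, (S ∘ .inl) a = b := by
        rcases triv₁ with h' | h'
        · exact ⟨_, hz₁.1 h'⟩
        · exact ⟨_, hc₁.1 h'⟩
      obtain ⟨b, hb⟩ := hb
      have hj0 : j = 0 := by
        have : ∀ a, S (.inl a) = b := hb
        simpa [this] using hj
      have hd := cut_of_const w hb
      subst hj0
      by_cases triv₂ : size (S ∘ .inr) = 0 ∨ size (S ∘ .inr) = 10
      · -- the cut separates the two sides of the gluing and has weight `2 * w x y`
        have hb' : ∀ a, (S ∘ .inr) a = !b := by
          rcases triv₁ with h₁ | h₁ <;> rcases triv₂ with h₂ | h₂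
          · omega
          · have e₁ := hz₁.1 h₁ x
            have e₂ := hc₂.1 h₂
            rw [hb x] at e₁
            subst e₁
            exact e₂
          · have e₁ := hc₁.1 h₁ x
            have e₂ := hz₂.1 h₂
            rw [hb x] at e₁
            subst e₁
            exact e₂
          · omega
        have := key₁ ((hb x).trans (hb y).symm) ((hb' 0).trans (hb' 1).symm)
          (by rw [show S (.inl x) = b from hb x, show S (.inr 0) = !b from hb' 0]; simp)
        rw [if_pos (by omega)]
        omega
      · push Not at triv₂
        have hd2 : (if (size (S ∘ .inr)) % 2 = 0 then t else r) ≤ cut (gadget n) (S ∘ .inr) := by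
          split_ifs with he
          · exact (hev he triv₂.1 triv₂.2).1
          · exact hodd (by omega)
        have hd3 : cut (gadget n) (S ∘ .inr) ≤ d := by
          rcases key₂ with hk | ⟨hk, -⟩
          · omega
          · exact absurd ((hb x).trans (hb y).symm) hk
        have : (size (S ∘ .inl) + size (S ∘ .inr) + 0) % 2 = size (S ∘ .inr) % 2 := by omega
        rw [this, mul_zero, zero_add]
        exact hd2.trans hd3
    push Not at triv₁
    have hcut := hcut triv₁.1 triv₁.2
    have hcutj := hcut j (hj.trans (Nat.le_add_right _ _))
    by_cases triv₂ : size (S ∘ .inr) = 0 ∨ size (S ∘ .inr) = 10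
    · have hb : ∃ b, ∀ a, (S ∘ .inr) a = b := by
        rcases triv₂ with h' | h'
        · exact ⟨_, hz₂.1 h'⟩
        · exact ⟨_, hc₂.1 h'⟩
      obtain ⟨b, hb⟩ := hb
      have hd3 : cut w (S ∘ .inl) ≤ d := by
        rcases key₂ with hk | ⟨-, hk, -⟩
        · omega
        · exact absurd ((hb 0).trans (hb 1).symm) hk
      have : (size (S ∘ .inl) + size (S ∘ .inr) + j) % 2 = (size (S ∘ .inl) + j) % 2 := by omega
      rw [this]
      exact hcutj.trans hd3
    push Not at triv₂
    rcases Nat.mod_two_eq_zero_or_one (size (S ∘ .inr)) with he | ho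
    · have h2 := hev he triv₂.1 triv₂.2
      have hd3 : cut w (S ∘ .inl) ≤ d := by
        rcases key₂ with hk | ⟨-, hk, hk'⟩
        · omega
        · have := h2.2 hk
          omega
      have : (size (S ∘ .inl) + size (S ∘ .inr) + j) % 2 = (size (S ∘ .inl) + j) % 2 := by omega
      rw [this]
      exact hcutj.trans hd3
    · have hd2 := hodd ho
      generalize size (S ∘ .inl) = s₁ at *
      generalize size (S ∘ .inr) = s₂ at *
      generalize cut w (S ∘ .inl) = d₁ at *
      generalize cut (gadget n) (S ∘ .inr) = d₂ at *
      rcases key₂ with hal | ⟨hk₁, -, hk₂⟩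
      · refine le_trans ?_ ((Nat.add_le_add_left hd2 _).trans hal)
        split_ifs at hcutj ⊢ <;> omega
      · -- a separated heavy edge costs `2 * w x y - r`, which is what `j + 1` pays for
        by_cases hlt : r < 2 * w x y
        · have hj1 := hcut (j + 1) (by
            rw [if_pos (by simpa [hlt] using hk₁)]
            exact Nat.succ_le_succ hj)
          rw [mul_add, mul_one] at hj1
          have hpar : (s₁ + (j + 1)) % 2 = (s₁ + s₂ + j) % 2 := by omega
          rw [hpar] at hj1
          generalize (if (s₁ + s₂ + j) % 2 = 0 then t else r) = L at *
          omega
        · split_ifs at hcutj ⊢ <;> omega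
  · intro e he
    obtain ⟨e, he', rfl⟩ := List.mem_map.1 he
    simpa using h.ne e (List.mem_cons_of_mem _ he')
  · intro e he
    obtain ⟨e, he', rfl⟩ := List.mem_map.1 he
    simp only [hwD e he']
    exact h.weight e (List.mem_cons_of_mem _ he')
  · rw [List.pairwise_map]
    simpa using (List.pairwise_cons.1 h.distinct).2
  · intro F hF
    obtain ⟨F₁, F₂, hF₁, hF₂, hcross, hrest⟩ := hF.of_glue h.symm (gadget_symm n) hxy h01
      (gadget_self n) hw01 (by decide)
    obtain ⟨e, he, hlt⟩ := h.no_packing F₁ hF₁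
    have hle := hF₂.le_card_gadget n (by rw [Fintype.card_fin]; omega)
    simp only [← hcross] at hle
    rcases List.mem_cons.1 he with rfl | he
    · simp only at hlt; omega
    · refine ⟨_, List.mem_map.2 ⟨e, he, rfl⟩, ?_⟩
      simp only [hwD e he]
      simpa only [hrest _ _ _ (hD e he).1 (hD e he).2] using hlt

/-! ### The base graph and the infinite family -/

/-- The coefficients of `h` in `baseWeight`. -/
def baseCoeffH : Fin 10 → Fin 10 → ℕ :=
  ![![0, 0, 0, 1, 2, 0, 0, 0, 0, 0], ![0, 0, 0, 1, 0, 2, 0, 0, 0, 0],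
    ![0, 0, 0, 1, 0, 0, 2, 0, 0, 0], ![1, 1, 1, 0, 0, 0, 0, 0, 0, 0],
    ![2, 0, 0, 0, 0, 0, 0, 1, 0, 0], ![0, 2, 0, 0, 0, 0, 0, 0, 1, 0],
    ![0, 0, 2, 0, 0, 0, 0, 0, 0, 1], ![0, 0, 0, 0, 1, 0, 0, 0, 1, 1],
    ![0, 0, 0, 0, 0, 1, 0, 1, 0, 1], ![0, 0, 0, 0, 0, 0, 1, 1, 1, 0]]

/-- The coefficients of `c` in `baseWeight`. -/
def baseCoeffC : Fin 10 → Fin 10 → ℕ :=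
  ![![0, 0, 0, 1, 0, 0, 0, 0, 0, 0], ![0, 0, 1, 0, 0, 0, 0, 0, 0, 0],
    ![0, 1, 0, 0, 0, 0, 0, 0, 0, 0], ![1, 0, 0, 0, 0, 0, 0, 0, 0, 0],
    ![0, 0, 0, 0, 0, 0, 0, 1, 0, 0], ![0, 0, 0, 0, 0, 0, 0, 0, 1, 0],
    ![0, 0, 0, 0, 0, 0, 0, 0, 0, 1], ![0, 0, 0, 0, 1, 0, 0, 0, 0, 0],
    ![0, 0, 0, 0, 0, 1, 0, 0, 0, 0], ![0, 0, 0, 0, 0, 0, 1, 0, 0, 0]]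

/-- The base graph, regular of degree `3 * h + c`. The vertices `4, 5, 6` have two neighbours each:
`i + 4` is joined to `i` with weight `2 * h` and to `i + 7` with weight `h + c`. The sets
`{0, 1, 2, 3}` and `{7, 8, 9}` are not joined to each other. -/
def baseWeight (h c : ℕ) (a b : Fin 10) : ℕ := h * baseCoeffH a b + c * baseCoeffC a b

/-- The edges of weight `2 * h` at `4, 5, 6`. -/
def baseLinksP : List (Fin 10 × Fin 10) := [(0, 4), (1, 5), (2, 6)]
/-- The edges of weight `h + c` at `4, 5, 6`. -/
def baseLinksQ : List (Fin 10 × Fin 10) := [(4, 7), (5, 8), (6, 9)]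

lemma cut_baseWeight (h c : ℕ) (S : Fin 10 → Bool) :
    cut (baseWeight h c) S = h * cut baseCoeffH S + c * cut baseCoeffC S := by
  simp only [cut, Finset.mul_sum, ← Finset.sum_add_distrib]
  refine Finset.sum_congr rfl fun a _ => Finset.sum_congr rfl fun b _ => ?_
  split_ifs <;> simp [baseWeight]

/-- The cut conditions of `IsGood` in terms of coefficients: the heavy links are those of weight
`h + c` if `h < c`, and those of weight `2 * h` if `h = c + 1`. The constant `6` in the latter case
absorbs `t = 4 * c + 2`, using `4 ≤ cut baseCoeffH S + cut baseCoeffC S` and `1 ≤ c`. -/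
lemma base_cuts (S : Fin 10 → Bool) : size S ≠ 0 → size S ≠ 10 →
    4 ≤ cut baseCoeffH S + cut baseCoeffC S ∧
    (∀ j < baseLinksQ.countP (fun e => S e.1 != S e.2) + 1, j + (size S + j) % 2 ≤ cut baseCoeffC S) ∧
    (∀ j < baseLinksP.countP (fun e => S e.1 != S e.2) + 1,
      j + (size S + j) % 2 + 6 ≤ 2 * cut baseCoeffH S + cut baseCoeffC S) := by
  refine forall_fin_ten_bool (P := fun S => size S ≠ 0 → size S ≠ 10 →
    4 ≤ cut baseCoeffH S + cut baseCoeffC S ∧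
    (∀ j < baseLinksQ.countP (fun e => S e.1 != S e.2) + 1, j + (size S + j) % 2 ≤ cut baseCoeffC S) ∧
    (∀ j < baseLinksP.countP (fun e => S e.1 != S e.2) + 1,
      j + (size S + j) % 2 + 6 ≤ 2 * cut baseCoeffH S + cut baseCoeffC S)) ?_ S
  decide +kernel

/-- At each of `4, 5, 6` a packing leaves two edges uncovered, hence exactly one on either side if
it leaves at most one copy of each link. Then the packing uses `3 * (2 * h - 1)` edges leaving
`{0, 1, 2, 3}`, an odd number, whereas every perfect matching leaves an even set evenly often. -/
lemma base_no_packing {h c : ℕ} (h1 : 1 ≤ h) (c1 : 1 ≤ c)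
    (F : Fin (3 * h + c - 2) → Fin 10 → Fin 10) (hF : IsPacking (baseWeight h c) F) :
    ∃ e ∈ baseLinksP ++ baseLinksQ,
      (Finset.univ.filter fun j => F j e.1 = e.2).card + 1 < baseWeight h c e.1 e.2 := by
  by_contra! hcon
  obtain ⟨k, hk⟩ : ∃ k : Fin 10 → Fin 10 → ℕ, ∀ a b,
      (Finset.univ.filter fun j => F j a = b).card = k a b := ⟨_, fun _ _ => rfl⟩
  have hle := hF.card_le
  have hsum := fun a => sum_card_filter_eq fun j => F j a
  have hs : ∀ a b, k a b = k b a := by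
    intro a b
    rw [← hk, ← hk]
    congr 1
    ext j
    simp only [Finset.mem_filter, Finset.mem_univ, true_and]
    exact ⟨fun h => by rw [← h, hF.invol], fun h => by rw [← h, hF.invol]⟩
  simp only [hk, Fintype.card_fin] at hle hsum hcon
  have h0 : ∀ a b, baseCoeffH a b = 0 → baseCoeffC a b = 0 → k a b = 0 := by
    intro a b ha hc
    simpa [baseWeight, ha, hc] using hle a b
  have row : ∀ a s, (Finset.univ.filter fun b => baseCoeffH a b ≠ 0 ∨ baseCoeffC a b ≠ 0) = s →
      ∑ b ∈ s, k a b = 3 * h + c - 2 := by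
    rintro a s rfl
    rw [Finset.sum_filter_of_ne, hsum]
    intro b _ hb
    by_contra! hne
    exact hb (h0 a b hne.1 hne.2)
  have e0 := row 0 {3, 4} (by decide)
  have e1 := row 1 {2, 3, 5} (by decide)
  have e2 := row 2 {1, 3, 6} (by decide)
  have e3 := row 3 {0, 1, 2} (by decide)
  have e4 := row 4 {0, 7} (by decide)
  have e5 := row 5 {1, 8} (by decide)
  have e6 := row 6 {2, 9} (by decide)
  have w : ∀ e ∈ baseLinksP ++ baseLinksQ, baseWeight h c e.1 e.2 ≤ k e.1 e.2 + 1 := hcon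
  simp [baseLinksP, baseLinksQ, baseWeight, baseCoeffH, baseCoeffC] at w
  have := hs 0 3; have := hs 0 4; have := hs 1 2; have := hs 1 3; have := hs 1 5
  have := hs 2 3; have := hs 2 6
  simp at e0 e1 e2 e3 e4 e5 e6
  omega

lemma isGood_base {r t h c : ℕ} (hr : r = 3 * h + c)
    (hc : (1 ≤ h ∧ h ≤ c ∧ c ≤ h + 2 ∧ t = 4 * h) ∨ (1 ≤ c ∧ h = c + 1 ∧ t = 4 * c + 2)) :
    IsGood r t (baseWeight h c) (baseLinksP ++ baseLinksQ) := by
  have hPw : ∀ e ∈ baseLinksP, baseWeight h c e.1 e.2 = 2 * h := by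
    simp [baseLinksP, baseWeight, baseCoeffH, baseCoeffC, mul_comm]
  have hQw : ∀ e ∈ baseLinksQ, baseWeight h c e.1 e.2 = h + c := by
    simp [baseLinksQ, baseWeight, baseCoeffH, baseCoeffC]
  refine ⟨?_, ?_, ?_, by decide, ?_, by decide, ?_, by decide, ?_⟩
  · have hA : ∀ a b, baseCoeffH a b = baseCoeffH b a := by decide
    have hC : ∀ a b, baseCoeffC a b = baseCoeffC b a := by decide
    intro a b
    rw [baseWeight, hA, hC, baseWeight]
  · have hA : ∀ a, baseCoeffH a a = 0 := by decide
    have hC : ∀ a, baseCoeffC a a = 0 := by decide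
    simp [baseWeight, hA, hC]
  · have hA : ∀ a, ∑ b, baseCoeffH a b = 3 := by decide
    have hC : ∀ a, ∑ b, baseCoeffC a b = 1 := by decide
    intro a
    simp only [baseWeight, Finset.sum_add_distrib, ← Finset.mul_sum, hA, hC, hr]
    omega
  · intro S hS0 hS1 j hj
    obtain ⟨h4, hQ, hP⟩ := base_cuts S hS0 hS1
    have hj : j ≤ (if c < h then baseLinksP.countP (fun e => S e.1 != S e.2) else 0) +
        (if h < c then baseLinksQ.countP (fun e => S e.1 != S e.2) else 0) := by
      refine hj.trans (le_of_eq ?_)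
      rw [List.countP_append]
      congr 1
      · split_ifs with hlt
        · refine List.countP_congr fun e he => ?_
          rw [hPw e he, decide_eq_true (by omega), Bool.and_true]
        · rw [List.countP_eq_zero]
          intro e he
          rw [hPw e he, decide_eq_false (by omega), Bool.and_false]
          decide
      · split_ifs with hlt
        · refine List.countP_congr fun e he => ?_
          rw [hQw e he, decide_eq_true (by omega), Bool.and_true]
        · rw [List.countP_eq_zero]
          intro e he
          rw [hQw e he, decide_eq_false (by omega), Bool.and_false]
          decide
    rw [cut_baseWeight]
    generalize cut baseCoeffH S = α at *
    generalize cut baseCoeffC S = γ at *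
    generalize size S = s at *
    rcases hc with ⟨h1, hle, hle', ht⟩ | ⟨c1, hlt, ht⟩
    · have hQj := hQ j (by split_ifs at hj <;> omega)
      have hm := Nat.mul_le_mul_left h h4
      rw [mul_add] at hm
      obtain ⟨d, rfl⟩ := Nat.exists_eq_add_of_le hle
      have hd := Nat.mul_le_mul_left d hQj
      have hrt : r - t = d := by omega
      rw [hrt, add_mul]
      rw [mul_add] at hd
      rcases Nat.mod_two_eq_zero_or_one (s + j) with hp | hp
      · rw [if_pos hp]
        rw [hp] at hd
        omega
      · rw [if_neg (by omega)]
        rw [hp] at hd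
        omega
    · have hPj := hP j (by split_ifs at hj <;> omega)
      obtain ⟨d, rfl⟩ := Nat.exists_eq_add_of_le c1
      have hm := Nat.mul_le_mul_left d h4
      rw [mul_add] at hm
      have hrt : r - t = 1 := by omega
      rw [hrt, hlt, add_mul, add_mul, add_mul]
      rcases Nat.mod_two_eq_zero_or_one (s + j) with hp | hp
      · rw [if_pos hp]
        omega
      · rw [if_neg (by omega)]
        omega
  · intro e he
    rcases List.mem_append.1 he with he | he
    · rw [hPw e he]; omega
    · rw [hQw e he]; omega
  · subst hr
    exact base_no_packing (by omega) (by omega)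

lemma exists_light_edge_base {t h c : ℕ}
    (hc : (1 ≤ h ∧ h ≤ c ∧ c ≤ h + 2 ∧ t = 4 * h) ∨ (1 ≤ c ∧ h = c + 1 ∧ t = 4 * c + 2)) :
    ∃ a b, a ≠ b ∧ 2 * baseWeight h c a b = t := by
  rcases hc with hc | hc
  · exact ⟨0, 4, by decide, by simp [baseWeight, baseCoeffH, baseCoeffC]; omega⟩
  · exact ⟨4, 7, by decide, by simp [baseWeight, baseCoeffH, baseCoeffC]; omega⟩

/-- Substitution preserves the existence of an edge of weight `t / 2`. Such an edge is not heavy, so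
it can be marked again without any condition on cuts. -/
lemma IsGood.substitute_light {r t : ℕ} (ht : t % 2 = 0) (h4 : 4 ≤ t) (htr : t ≤ r)
    (hrt : r ≤ t + 2) {V : Type} [Fintype V] [DecidableEq V] {w : V → V → ℕ} {x y : V}
    {D : List (V × V)} (h : IsGood r t w ((x, y) :: D))
    (hl : ∃ a b, a ≠ b ∧ 2 * w a b = t) :
    ∃ w' : V ⊕ Fin 10 → V ⊕ Fin 10 → ℕ,
      IsGood r t w' (D.map fun e => (Sum.inl e.1, Sum.inl e.2)) ∧
      ∃ a b, a ≠ b ∧ 2 * w' a b = t := by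
  obtain ⟨n, hn⟩ := h.substitute ht h4 htr hrt
  refine ⟨_, hn, ?_⟩
  obtain ⟨a, b, hab, hw⟩ := hl
  by_cases hxy : (a = x ∧ b = y) ∨ (a = y ∧ b = x)
  · refine ⟨.inl x, .inr 0, by simp, ?_⟩
    rcases hxy with ⟨rfl, rfl⟩ | ⟨rfl, rfl⟩
    · simpa [glue] using hw
    · rw [h.symm] at hw
      simpa [glue] using hw
  · exact ⟨.inl a, .inl b, by simpa using hab, by simpa [glue, hxy] using hw⟩

lemma IsGood.substitute_all {r t : ℕ} (ht : t % 2 = 0) (h4 : 4 ≤ t) (htr : t ≤ r)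
    (hrt : r ≤ t + 2) (k : ℕ) :
    ∀ (V : Type) [Fintype V] [DecidableEq V] (w : V → V → ℕ) (D : List (V × V)),
      D.length = k → IsGood r t w D → (∃ a b, a ≠ b ∧ 2 * w a b = t) →
    ∃ (V' : Type) (_ : Fintype V') (_ : DecidableEq V') (w' : V' → V' → ℕ),
      IsGood r t w' [] ∧ (∃ a b, a ≠ b ∧ 2 * w' a b = t) ∧
      Fintype.card V' = Fintype.card V + 10 * k := by
  induction k with
  | zero =>
    intro V _ _ w D hD h hl
    rw [List.length_eq_zero_iff] at hD
    exact ⟨V, _, _, w, hD ▸ h, hl, by simp⟩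
  | succ k ih =>
    intro V _ _ w D hD h hl
    match D, hD, h with
    | (x, y) :: D, hD, h =>
      obtain ⟨w', h', hl'⟩ := h.substitute_light ht h4 htr hrt hl
      obtain ⟨V', i₁, i₂, w'', h'', hl'', hcard⟩ := ih _ w' _ (by simpa using hD) h' hl'
      refine ⟨V', i₁, i₂, w'', h'', hl'', ?_⟩
      rw [hcard, Fintype.card_sum, Fintype.card_fin]
      ring

lemma exists_isGood {r t : ℕ} (ht : t % 2 = 0) (h4 : 4 ≤ t) (htr : t ≤ r) (hrt : r ≤ t + 2)
    {h c : ℕ} (hr : r = 3 * h + c)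
    (hc : (1 ≤ h ∧ h ≤ c ∧ c ≤ h + 2 ∧ t = 4 * h) ∨ (1 ≤ c ∧ h = c + 1 ∧ t = 4 * c + 2)) (N : ℕ) :
    ∃ (V : Type) (_ : Fintype V) (_ : DecidableEq V) (w : V → V → ℕ),
      IsGood r t w [] ∧ (∃ a b, a ≠ b ∧ 2 * w a b = t) ∧ Fintype.card V = 70 + 10 * N := by
  induction N with
  | zero =>
    exact IsGood.substitute_all ht h4 htr hrt 6 _ _ _ rfl (isGood_base hr hc)
      (exists_light_edge_base hc)
  | succ N ih =>
    obtain ⟨V, _, _, w, hg, ⟨a, b, hab, hw⟩, hcard⟩ := ih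
    have hg' : IsGood r t w [(a, b)] := by
      refine ⟨hg.symm, hg.self, hg.reg, hg.even, fun S h0 h1 j hj => ?_, by simpa using hab,
        by simp [hw], by simp, fun F hF => ?_⟩
      · refine hg.le_cut S h0 h1 j (hj.trans (le_of_eq ?_))
        simp [hw, htr]
      · obtain ⟨e, he, -⟩ := hg.no_packing F hF
        simp at he
    obtain ⟨w', h', hl'⟩ := hg'.substitute_light ht h4 htr hrt ⟨a, b, hab, hw⟩
    exact ⟨_, _, _, w', h', hl', by rw [Fintype.card_sum, Fintype.card_fin, hcard]; ring⟩

/-! ### Multigraphs from weights -/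

variable {w : V → V → ℕ}

/-- The multigraph in which `a` and `b` are joined by the `w a b` edges `(s(a, b), i)` with
`i < w a b`. -/
def toGraph (w : V → V → ℕ) (hw : ∀ a b, w a b = w b a) : Graph V (Sym2 V × ℕ) where
  vertexSet := Set.univ
  IsLink e a b := e.1 = s(a, b) ∧ e.2 < w a b
  isLink_symm e _ := ⟨fun a b h => ⟨h.1.trans Sym2.eq_swap, hw a b ▸ h.2⟩⟩
  eq_or_eq_of_isLink_of_isLink e x y u v h h' := by
    have := h.1.symm.trans h'.1
    rw [Sym2.eq_iff] at this
    tauto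
  left_mem_of_isLink _ _ _ _ := Set.mem_univ _

/-- The number of edges over the pairs in `T`, if `T` contains no pair in both orders. -/
lemma encard_setOf_edges [DecidableEq V] (w : V → V → ℕ) (T : Finset (V × V))
    (hT : ∀ p ∈ T, p.swap ∈ T → p.swap = p) :
    {e : Sym2 V × ℕ | ∃ p ∈ T, e.1 = s(p.1, p.2) ∧ e.2 < w p.1 p.2}.encard =
      ((∑ p ∈ T, w p.1 p.2 : ℕ) : ℕ∞) := by
  have himage : {e : Sym2 V × ℕ | ∃ p ∈ T, e.1 = s(p.1, p.2) ∧ e.2 < w p.1 p.2} =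
      (((T.sigma fun p => Finset.range (w p.1 p.2)).image
        fun q => ((s(q.1.1, q.1.2), q.2) : Sym2 V × ℕ) : Finset (Sym2 V × ℕ)) :
          Set (Sym2 V × ℕ)) := by
    ext ⟨e, i⟩
    simp only [Set.mem_ofPred_eq, Finset.coe_image, Set.mem_image, Finset.mem_coe,
      Finset.mem_sigma, Finset.mem_range, Prod.mk.injEq]
    constructor
    · rintro ⟨p, hp, rfl, hi⟩
      exact ⟨⟨p, i⟩, ⟨hp, hi⟩, rfl, rfl⟩
    · rintro ⟨⟨p, j⟩, ⟨hp, hi⟩, rfl, rfl⟩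
      exact ⟨p, hp, rfl, hi⟩
  rw [himage, Set.encard_coe_eq_coe_finsetCard, Finset.card_image_of_injOn, Finset.card_sigma]
  · simp
  · rintro ⟨p, i⟩ hp ⟨q, j⟩ hq h
    simp only [Finset.coe_sigma, Set.mem_sigma_iff, Finset.mem_coe] at hp hq
    simp only [Prod.mk.injEq] at h
    obtain ⟨h, rfl⟩ := h
    have : p = q := by
      rcases Sym2.mk_eq_mk_iff.1 h with h | h
      · exact h
      · have hs := hT q hq.1 (h ▸ hp.1)
        rw [h, hs]
    subst this
    rfl

lemma toGraph_loopless (hw : ∀ a b, w a b = w b a) (hl : ∀ a, w a a = 0) :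
    (toGraph w hw).Loopless where
  not_isLoopAt e x h := by
    have := h.2
    rw [hl] at this
    exact absurd this (Nat.not_lt_zero _)

lemma toGraph_isFiniteLoopless [Fintype V] (hw : ∀ a b, w a b = w b a) (hl : ∀ a, w a a = 0) :
    (toGraph w hw).IsFiniteLoopless where
  finite_vertexSet := Set.toFinite _
  finite_edgeSet := by
    classical
    refine Set.Finite.subset ((Set.finite_univ (α := Sym2 V)).prod
      (Set.finite_lt_nat (∑ a, ∑ b, w a b))) ?_
    rintro e he
    obtain ⟨a, b, -, h⟩ := he
    refine ⟨Set.mem_univ _, h.trans_le ?_⟩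
    exact (Finset.single_le_sum (f := fun b => w a b) (fun _ _ => Nat.zero_le _)
      (Finset.mem_univ b)).trans (Finset.single_le_sum (f := fun a => ∑ b, w a b)
        (fun _ _ => Nat.zero_le _) (Finset.mem_univ a))
  loopless := toGraph_loopless hw hl

lemma vertexDegree_of_loopless {α β : Type*} {G : Graph α β} (hG : G.Loopless) (v : α) :
    G.vertexDegree v = {e | G.Inc e v}.encard := by
  have : {e | G.IsLoopAt e v} = ∅ := by
    ext e; simp
  rw [Graph.vertexDegree, this, Set.encard_empty, add_zero]

lemma toGraph_isRegular [Fintype V] (hw : ∀ a b, w a b = w b a) (hl : ∀ a, w a a = 0) {r : ℕ}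
    (hr : ∀ a, ∑ b, w a b = r) : (toGraph w hw).IsRegular r := by
  classical
  intro v _
  rw [vertexDegree_of_loopless (toGraph_loopless hw hl), ← hr v]
  have h := encard_setOf_edges w (({v} : Finset V) ×ˢ Finset.univ) (by
    rintro ⟨a, b⟩ h h'
    simp at h h'
    simp [← h, ← h'])
  rw [Finset.sum_product, Finset.sum_singleton] at h
  rw [← h]
  congr 1
  ext e
  simp [Graph.Inc, toGraph]

lemma toGraph_edgeBoundary [Fintype V] (hw : ∀ a b, w a b = w b a) (S : V → Bool) :
    ((toGraph w hw).edgeBoundary {a | S a = true}).encard = cut w S := by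
  classical
  have h := encard_setOf_edges w
    (((Finset.univ : Finset V) ×ˢ Finset.univ).filter fun p => S p.1 && !S p.2) (by
      rintro ⟨a, b⟩ h h'
      simp at h h'
      simp [h.1] at h')
  rw [Finset.sum_filter, Finset.sum_product] at h
  rw [cut, ← h]
  congr 1
  ext e
  simp only [Graph.edgeBoundary, toGraph, Set.mem_ofPred_eq, Prod.exists, Finset.mem_filter,
    Finset.mem_product, Finset.mem_univ, true_and, Bool.and_eq_true, Bool.not_eq_true',
    Bool.not_eq_true]
  exact exists_congr fun a => exists_congr fun b => by tauto

lemma size_decide_mem [Fintype V] (S : Set V) [DecidablePred (· ∈ S)] :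
    size (fun a => decide (a ∈ S)) = S.ncard := by
  rw [Set.ncard_eq_toFinset_card', size, ← Set.filter_mem_univ_eq_toFinset, Finset.card_filter]
  refine Finset.sum_congr rfl fun a _ => ?_
  by_cases h : a ∈ S <;> simp [h]

lemma IsGood.toGraph_isRGraph [Fintype V] [DecidableEq V] {r t : ℕ} (h : IsGood r t w []) :
    (toGraph w h.symm).IsRGraph r := by
  classical
  refine ⟨toGraph_isRegular h.symm h.self h.reg, fun S _ hS => ?_⟩
  rw [← size_decide_mem, Nat.odd_iff] at hS
  have hV := Nat.even_iff.1 h.even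
  have hcut := h.le_cut (fun a => decide (a ∈ S)) (by omega) (by omega) 0 (Nat.zero_le _)
  rw [if_neg (by omega), mul_zero, zero_add] at hcut
  have hb := toGraph_edgeBoundary h.symm fun a => decide (a ∈ S)
  simp only [decide_eq_true_eq, Set.ofPred_mem_eq] at hb
  rw [hb]
  exact_mod_cast hcut

lemma IsGood.toGraph_isEdgeConnected [Fintype V] [DecidableEq V] [Nontrivial V] {r t : ℕ}
    (htr : t ≤ r) (h : IsGood r t w []) : (toGraph w h.symm).IsEdgeConnected t := by
  classical
  refine ⟨Set.nontrivial_univ, fun F _ hF x _ y _ => ?_⟩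
  by_contra hxy
  -- the edges leaving the component of `x` have all been deleted
  let S : Set V := {z | Relation.ReflTransGen ((toGraph w h.symm).deleteEdges F).Adj x z}
  have hcut := h.le_cut (fun a => decide (a ∈ S))
    (fun h0 => by
      have := (size_eq_zero_iff _).1 h0 x
      have hx : x ∈ S := Relation.ReflTransGen.refl
      simp [hx] at this)
    (fun h1 => hxy (by simpa [S] using (size_eq_card_iff _).1 h1 y)) 0 (Nat.zero_le _)
  rw [mul_zero, zero_add] at hcut
  have hb := toGraph_edgeBoundary h.symm fun a => decide (a ∈ S)
  simp only [decide_eq_true_eq, Set.ofPred_mem_eq] at hb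
  have hsub : (toGraph w h.symm).edgeBoundary S ⊆ F := by
    rintro e ⟨a, b, hab, ha, hb⟩
    by_contra he
    exact hb (Relation.ReflTransGen.tail ha ⟨e, by simpa using ⟨hab, he⟩⟩)
  have hle := (Set.encard_le_encard hsub).trans_lt hF
  rw [hb] at hle
  have : cut w (fun a => decide (a ∈ S)) < t := by exact_mod_cast hle
  split_ifs at hcut <;> omega

lemma exists_isPacking_of_oneFactors [Fintype V] [DecidableEq V] (hw : ∀ a b, w a b = w b a)
    (hl : ∀ a, w a a = 0) {k : ℕ} (h : (toGraph w hw).HasDisjointOneFactors k) :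
    ∃ F : Fin k → V → V, IsPacking w F := by
  obtain ⟨M, hM, hdisj⟩ := h
  have hloop : ∀ i, (M i).Loopless := fun i =>
    haveI := toGraph_loopless hw hl
    Graph.Loopless.anti (hM i).1.le
  have huniq : ∀ i v, ∃ e, {e | (M i).Inc e v} = {e} := by
    intro i v
    have := (hM i).2 v (by rw [(hM i).1.vertexSet_eq]; exact Set.mem_univ v)
    rw [vertexDegree_of_loopless (hloop i)] at this
    exact Set.encard_eq_one.1 (by simpa using this)
  choose e he using huniq
  have hinc : ∀ i v, (M i).Inc (e i v) v := fun i v => by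
    have : e i v ∈ {e | (M i).Inc e v} := by rw [he]; rfl
    exact this
  have heq : ∀ i v f, (M i).Inc f v → f = e i v := fun i v f hf => by
    have : f ∈ {e | (M i).Inc e v} := hf
    rwa [he] at this
  choose F hF using hinc
  refine ⟨F, fun i v => ?_, fun a b => ?_⟩
  · have h₁ := (hF i v).symm
    rw [heq i _ _ h₁.inc_left] at h₁
    exact (hF i (F i v)).right_unique h₁
  · rw [← Finset.card_range (w a b)]
    have hG : ∀ i, (toGraph w hw).IsLink (e i a) a (F i a) := fun i =>
      (hM i).1.le.isLink_mono (hF i a)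
    refine Finset.card_le_card_of_injOn (fun i => (e i a).2) ?_ ?_
    · intro i hi
      have hi : F i a = b := by simpa using hi
      have := (hG i).2
      rw [hi] at this
      simpa using this
    · intro i hi j hj hij
      have hi : F i a = b := by simpa using hi
      have hj : F j a = b := by simpa using hj
      have heij : e i a = e j a :=
        Prod.ext ((hG i).1.trans (by rw [hi, (hG j).1, hj])) hij
      by_contra hne
      exact Set.disjoint_left.1 (hdisj hne) (hF i a).edge_mem (heij ▸ (hF j a).edge_mem)

lemma IsGood.not_hasDisjointOneFactors [Fintype V] [DecidableEq V] {r t : ℕ}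
    (h : IsGood r t w []) : ¬ (toGraph w h.symm).HasDisjointOneFactors (r - 2) := by
  intro hf
  obtain ⟨F, hF⟩ := exists_isPacking_of_oneFactors h.symm h.self hf
  obtain ⟨e, he, -⟩ := h.no_packing F hF
  simp at he

end WeightedGraph

namespace Graph

/-- The degrees add up to `r` at every vertex, so the factors of such a union must be disjoint. -/
lemma IsUnionOfOneFactorsAndTwoFactor.hasDisjointOneFactors {α β : Type*} {G : Graph α β}
    {r : ℕ} (hr : 2 ≤ r) (hl : G.Loopless) (hG : G.IsRegular r)
    (h : G.IsUnionOfOneFactorsAndTwoFactor (r - 2)) : G.HasDisjointOneFactors (r - 2) := by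
  classical
  obtain ⟨M, H, hM, hH, hE⟩ := h
  refine ⟨M, hM, fun i j hij => Set.disjoint_left.2 fun e hei hej => ?_⟩
  obtain ⟨v, u, huv⟩ := exists_isLink_of_mem_edgeSet hei
  have hv : v ∈ V(G) := (hM i).1.vertexSet_eq ▸ huv.left_mem
  have huvG := (hM i).1.le.isLink_mono huv
  have hvj : (M j).Inc e v := by
    obtain ⟨a, b, hab⟩ := exists_isLink_of_mem_edgeSet hej
    rcases huvG.left_eq_or_eq ((hM j).1.le.isLink_mono hab) with rfl | rfl
    exacts [hab.inc_left, hab.inc_right]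
  have hdeg : ∀ {K : Graph α β} {k : ℕ}, K.IsFactor G k → {e | K.Inc e v}.encard = k := by
    intro K k hK
    rw [← WeightedGraph.vertexDegree_of_loopless (Loopless.anti hK.1.le)]
    exact hK.2 v (hK.1.vertexSet_eq ▸ hv)
  have hone : ∀ k, ∃ f, {e | (M k).Inc e v} = {f} := fun k =>
    Set.encard_eq_one.1 (by simpa using hdeg (hM k))
  choose m hm using hone
  have hmem : ∀ k f, (M k).Inc f v → f = m k := fun k f hf => by
    have : f ∈ {e | (M k).Inc e v} := hf
    rwa [hm] at this
  have hmij : m i = m j := (hmem i e huv.inc_left).symm.trans (hmem j e hvj)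
  have hcard : (Finset.univ.image m).card < r - 2 := by
    refine lt_of_le_of_ne (by simpa using Finset.card_image_le (s := Finset.univ) (f := m)) ?_
    intro hc
    exact hij (Finset.card_image_iff.1 (hc.trans (by simp)) (Finset.mem_coe.2 (Finset.mem_univ i))
      (Finset.mem_coe.2 (Finset.mem_univ j)) hmij)
  have hsub : {e | G.Inc e v} ⊆ ((Finset.univ.image m : Finset β) : Set β) ∪ {e | H.Inc e v} := by
    rintro f ⟨x, hf⟩
    have hfE := hf.edge_mem
    have key : ∀ {K : Graph α β}, K ≤ G → f ∈ E(K) → K.Inc f v := by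
      intro K hK hfK
      obtain ⟨a, b, hab⟩ := exists_isLink_of_mem_edgeSet hfK
      rcases hf.left_eq_or_eq (hK.isLink_mono hab) with rfl | rfl
      exacts [hab.inc_left, hab.inc_right]
    rw [hE] at hfE
    rcases hfE with hfE | hfE
    · obtain ⟨k, hk⟩ := Set.mem_iUnion.1 hfE
      left
      simpa using ⟨k, (hmem k f (key (hM k).1.le hk)).symm⟩
    · exact Or.inr (key hH.1.le hfE)
  have hle := (Set.encard_le_encard hsub).trans (Set.encard_union_le _ _)
  rw [← WeightedGraph.vertexDegree_of_loopless hl, hG v hv, hdeg hH,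
    Set.encard_coe_eq_coe_finsetCard] at hle
  have : r ≤ (Finset.univ.image m).card + 2 := by exact_mod_cast hle
  omega

end Graph

theorem theorem1 (r t : ℕ) (hr : 4 ≤ r)
    (ht0 : r % 4 = 0 → t = r)
    (ht1 : r % 2 = 1 → t = r - 1)
    (ht2 : r % 4 = 2 → t = r - 2) :
    (∃ (α β : ℕ → Type) (G : (n : ℕ) → Graph (α n) (β n)),
      (∀ n, (G n).IsFiniteLoopless ∧ (G n).IsRGraph r ∧ (G n).IsEdgeConnected t ∧
        ¬ (G n).HasDisjointOneFactors (r - 2)) ∧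
      Pairwise fun m n => ¬ (G m).IsIsomorphic (G n)) ∧
    (4 ∣ r → ¬ ThomassenProperty r) := by
  have hparam : ∃ h c, r = 3 * h + c ∧ ((1 ≤ h ∧ h ≤ c ∧ c ≤ h + 2 ∧ t = 4 * h) ∨
      (1 ≤ c ∧ h = c + 1 ∧ t = 4 * c + 2)) := by
    have : r % 4 = 0 ∨ r % 4 = 1 ∨ r % 4 = 2 ∨ r % 4 = 3 := by omega
    rcases this with h | h | h | h
    · exact ⟨r / 4, r / 4, by omega, by omega⟩
    · exact ⟨r / 4, r / 4 + 1, by omega, by omega⟩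
    · exact ⟨r / 4, r / 4 + 2, by omega, by omega⟩
    · exact ⟨r / 4 + 1, r / 4, by omega, by omega⟩
  obtain ⟨h, c, hrhc, hc⟩ := hparam
  have htr : t ≤ r := by omega
  choose V i₁ i₂ w hgood _ hcard using WeightedGraph.exists_isGood (r := r) (t := t)
    (by omega) (by omega) htr (by omega) hrhc hc
  have hnt : ∀ n, Nontrivial (V n) := fun n =>
    Fintype.one_lt_card_iff_nontrivial.1 (by rw [hcard]; omega)
  have hall : ∀ n, (WeightedGraph.toGraph (w n) (hgood n).symm).IsFiniteLoopless ∧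
      (WeightedGraph.toGraph (w n) (hgood n).symm).IsRGraph r ∧
      (WeightedGraph.toGraph (w n) (hgood n).symm).IsEdgeConnected t ∧
      ¬ (WeightedGraph.toGraph (w n) (hgood n).symm).HasDisjointOneFactors (r - 2) := fun n =>
    ⟨WeightedGraph.toGraph_isFiniteLoopless _ (hgood n).self, (hgood n).toGraph_isRGraph,
      (hgood n).toGraph_isEdgeConnected htr, (hgood n).not_hasDisjointOneFactors⟩
  refine ⟨⟨V, fun n => Sym2 (V n) × ℕ, fun n => WeightedGraph.toGraph (w n) (hgood n).symm,
    hall, ?_⟩, ?_⟩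
  · rintro m n hmn ⟨f, -, -⟩
    have hcong := Nat.card_congr f
    have huniv : ∀ n, Nat.card V(WeightedGraph.toGraph (w n) (hgood n).symm) = 70 + 10 * n := by
      intro n
      rw [← hcard n, ← Nat.card_eq_fintype_card]
      exact Nat.card_congr (Equiv.Set.univ (V n))
    rw [huniv, huniv] at hcong
    omega
  · intro h4 hT
    obtain ⟨hfin, hreg, hconn, hno⟩ := hall 0
    have htr' : t = r := ht0 (by omega)
    refine hno ((hT _ _ _ hfin hreg.1 (htr' ▸ hconn) ?_).hasDisjointOneFactors (by omega)
      hfin.loopless hreg.1)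
    have : V(WeightedGraph.toGraph (w 0) (hgood 0).symm) = Set.univ := rfl
    rw [this, Set.ncard_univ, Nat.card_eq_fintype_card]
    exact (hgood 0).even
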